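/- Let $r\ge 3$ be an integer and $0\le\rho<1$. In game $A$ a fair coin is tossed. In game $B$ a coin is tossed whose probability of heads is $p_0=\rho^{r-1}/(1+\rho^{r-1})$ if the player's current (integer) capital is a multiple of $r$, and $p_1=1/(1+\rho)$ otherwise; for $\rho=0$ this means $p_0=0$ and $p_1=1$. In either game the player wins one unit with heads and loses one unit with tails. For $0<\gamma<1$, in the random mixture $\gamma A+(1-\gamma)B$, at each turn, independently of the past, game $A$ is played with probability $\gamma$ and game $B$ is played otherwise. Its rate of profit $\mu(r,\rho,\gamma A+(1-\gamma)B)$ is the almost sure limit, as $n\to\infty$, of the cumulative profit after $n$ turns divided by $n$. For each integer $r\ge 5$ put $\gamma_r:=2/\sqrt r$, so that $0<\gamma_r<1$. Then the rate of profit $\mu(r,0,\gamma_rA+(1-\gamma_r)B)$ exists and is the same for every initial capital $x\in\mathbb Z$, and $$1-\mu(r,0,\gamma_rA+(1-\gamma_r)B)\sim 2\gamma_r=\frac{4}{\sqrt r}\qquad\text{as } r\to\infty .$$ -/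

import Mathlib

open MeasureTheory ProbabilityTheory Filter Asymptotics
open scoped Topology NNReal ENNReal unitInterval

namespace Parrondo

noncomputable section

/-- Law of the capital after one turn that starts from capital `x` and is decided by a `p`-coin:
heads (probability `p`) wins one unit, tails (probability `1 - p`) loses one unit. -/
def coinStep (p : I) (x : ℤ) : Measure ℤ :=
  ENNReal.ofReal (p : ℝ) • Measure.dirac (x + 1)
    + ENNReal.ofReal (1 - (p : ℝ)) • Measure.dirac (x - 1)

instance (p : I) (x : ℤ) : IsProbabilityMeasure (coinStep p x) := by
  refine ⟨?_⟩
  simp only [coinStep, Measure.add_apply, Measure.smul_apply, measure_univ, smul_eq_mul, mul_one]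
  rw [← ENNReal.ofReal_add p.2.1 (sub_nonneg.2 p.2.2)]
  simp

/-- The fair coin. -/
def pA : I := ⟨1 / 2, by norm_num, by norm_num⟩

/-- The coin of game `B` when capital is a multiple of `r`: `p₀ = ρ ^ (r - 1) / (1 + ρ ^ (r - 1))`. -/
def p0 (r : ℕ) (ρ : ℝ≥0) : I :=
  ⟨(ρ : ℝ) ^ (r - 1) / (1 + (ρ : ℝ) ^ (r - 1)), by positivity,
    by rw [div_le_one (by positivity)]; linarith⟩

/-- The coin of game `B` when capital is not a multiple of `r`: `p₁ = 1 / (1 + ρ)`. -/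
def p1 (ρ : ℝ≥0) : I :=
  ⟨1 / (1 + (ρ : ℝ)), by positivity,
    by rw [div_le_one (by positivity)]; linarith [ρ.2]⟩

/-- One turn of game `A`. -/
def gameA (x : ℤ) : Measure ℤ := coinStep pA x

/-- One turn of game `B`. -/
def gameB (r : ℕ) (ρ : ℝ≥0) (x : ℤ) : Measure ℤ :=
  coinStep (if (r : ℤ) ∣ x then p0 r ρ else p1 ρ) x

instance (x : ℤ) : IsProbabilityMeasure (gameA x) := by
  unfold gameA; infer_instance

instance (r : ℕ) (ρ : ℝ≥0) (x : ℤ) : IsProbabilityMeasure (gameB r ρ x) := by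
  unfold gameB; infer_instance

/-- One turn of the random mixture `γ A + (1 - γ) B`, as a transition kernel for capital:
game `A` is played with probability `γ` and game `B` is played otherwise. -/
def mixture (r : ℕ) (ρ : ℝ≥0) (γ : I) : Kernel ℤ ℤ where
  toFun x := ENNReal.ofReal (γ : ℝ) • gameA x + ENNReal.ofReal (1 - (γ : ℝ)) • gameB r ρ x
  measurable' := measurable_of_countable _

instance (r : ℕ) (ρ : ℝ≥0) (γ : I) : IsMarkovKernel (mixture r ρ γ) := by
  refine ⟨fun x => ⟨?_⟩⟩
  change (ENNReal.ofReal (γ : ℝ) • gameA x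
    + ENNReal.ofReal (1 - (γ : ℝ)) • gameB r ρ x) Set.univ = 1
  simp only [Measure.add_apply, Measure.smul_apply, measure_univ, smul_eq_mul, mul_one]
  rw [← ENNReal.ofReal_add γ.2.1 (sub_nonneg.2 γ.2.2)]
  simp

/-- The transition from the capitals at times `0, …, n` to the capital at time `n + 1`; it depends
on the present capital only. -/
def transition (r : ℕ) (ρ : ℝ≥0) (γ : I) (n : ℕ) :
    Kernel ((_ : Finset.Iic n) → ℤ) ℤ :=
  (mixture r ρ γ).comap (fun h => h ⟨n, Finset.mem_Iic.2 le_rfl⟩) (measurable_pi_apply _)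

instance (r : ℕ) (ρ : ℝ≥0) (γ : I) (n : ℕ) : IsMarkovKernel (transition r ρ γ n) := by
  unfold transition; infer_instance

/-- The law, on the space of sequences `c 0, c 1, c 2, …` of capitals, of the Markov chain of
capitals when the mixture `γ A + (1 - γ) B` is played at every turn, starting from initial
capital `x`. -/
def capitalLaw (r : ℕ) (ρ : ℝ≥0) (γ : I) (x : ℤ) : Measure (ℕ → ℤ) :=
  Kernel.traj (X := fun _ => ℤ) (transition r ρ γ) 0 (fun _ => x)

instance (r : ℕ) (ρ : ℝ≥0) (γ : I) (x : ℤ) : IsProbabilityMeasure (capitalLaw r ρ γ x) := by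
  unfold capitalLaw; infer_instance

/-- `m` is the rate of profit `μ(r, ρ, γ A + (1 - γ) B)` from initial capital `x`: the cumulative
profit after `n` turns, divided by `n`, converges to `m` almost surely. -/
def IsRateOfProfit (r : ℕ) (ρ : ℝ≥0) (γ : I) (x : ℤ) (m : ℝ) : Prop :=
  ∀ᵐ c ∂(capitalLaw r ρ γ x),
    Tendsto (fun n : ℕ => ((c n - c 0 : ℤ) : ℝ) / (n : ℝ)) atTop (𝓝 m)

/-- There is at most one rate of profit. -/
theorem IsRateOfProfit.unique {r : ℕ} {ρ : ℝ≥0} {γ : I} {x : ℤ} {m m' : ℝ}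
    (h : IsRateOfProfit r ρ γ x m) (h' : IsRateOfProfit r ρ γ x m') : m = m' := by
  obtain ⟨c, hc, hc'⟩ := (h.and h').exists
  exact tendsto_nhds_unique hc hc'

/-- `γ_r = 2 / √r` as a probability. It is less than `1` exactly when `r ≥ 5`. -/
def gammaSeq (r : ℕ) (hr : 5 ≤ r) : I :=
  ⟨2 / √(r : ℝ), by positivity, by
    have h4 : (5 : ℝ) ≤ r := by exact_mod_cast hr
    have h2 : (2 : ℝ) ≤ √(r : ℝ) := Real.le_sqrt_of_sq_le (by linarith)
    exact (div_le_one (by linarith)).2 h2⟩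

end

end Parrondo

namespace Parrondo

noncomputable section

/-! The rate comes from a Poisson equation: if `f` stays at bounded distance from the identity and
one turn changes `f` by `m` on average, then `f (c n) - f x - n m` is a martingale with bounded
increments. Its second moment is O(n), so after division by `n` it tends to 0 almost surely along
the squares, and unit steps fill the gaps (`isRateOfProfit_of_poisson`).

For ρ = 0 and q = γ/2 the walk wins with probability q at multiples of r and 1 - q elsewhere. Away
from multiples the solutions are a linear term plus a multiple of s ^ k, s = q/(1 - q); periodicity
and the equation at multiples of r fix `m` explicitly (`isRateOfProfit_profitRate`).

With q = 1/√r, qr = 1/q, so m = (1 - 2q)/(1 + 2q(1 - q)κ) with κ → 1. The reduced drift and the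
delay at multiples of r each cost about 2q, in total 4q = 2γ. -/

/-- The probability that a turn of the mixture started from capital `y` wins one unit. -/
def winProb (r : ℕ) (ρ : ℝ≥0) (γ : I) (y : ℤ) : ℝ :=
  (γ : ℝ) * (1 / 2) + (1 - (γ : ℝ)) * ((if (r : ℤ) ∣ y then p0 r ρ else p1 ρ : I) : ℝ)

theorem winProb_nonneg (r : ℕ) (ρ : ℝ≥0) (γ : I) (y : ℤ) : 0 ≤ winProb r ρ γ y := by
  unfold winProb
  have h1 := γ.2.1
  have h2 : (0 : ℝ) ≤ 1 - γ := sub_nonneg.2 γ.2.2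
  have h3 := (if (r : ℤ) ∣ y then p0 r ρ else p1 ρ : I).2.1
  positivity

theorem winProb_le_one (r : ℕ) (ρ : ℝ≥0) (γ : I) (y : ℤ) : winProb r ρ γ y ≤ 1 := by
  unfold winProb
  have h1 := γ.2.1
  have h2 : (0 : ℝ) ≤ 1 - γ := sub_nonneg.2 γ.2.2
  have h3 := (if (r : ℤ) ∣ y then p0 r ρ else p1 ρ : I).2.2
  nlinarith

theorem lintegral_coinStep (p : I) (y : ℤ) (g : ℤ → ℝ≥0∞) :
    ∫⁻ z, g z ∂coinStep p y
      = ENNReal.ofReal p * g (y + 1) + ENNReal.ofReal (1 - (p : ℝ)) * g (y - 1) := by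
  simp [coinStep]

theorem lintegral_mixture (r : ℕ) (ρ : ℝ≥0) (γ : I) (y : ℤ) (g : ℤ → ℝ≥0∞) :
    ∫⁻ z, g z ∂mixture r ρ γ y
      = ENNReal.ofReal (winProb r ρ γ y) * g (y + 1)
        + ENNReal.ofReal (1 - winProb r ρ γ y) * g (y - 1) := by
  change ∫⁻ z, g z ∂(ENNReal.ofReal (γ : ℝ) • gameA y
    + ENNReal.ofReal (1 - (γ : ℝ)) • gameB r ρ y) = _
  rw [lintegral_add_measure, lintegral_smul_measure, lintegral_smul_measure, gameA, gameB,
    lintegral_coinStep, lintegral_coinStep]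
  have hw : 1 - winProb r ρ γ y = (γ : ℝ) * (1 - (pA : ℝ))
      + (1 - (γ : ℝ)) * (1 - ((if (r : ℤ) ∣ y then p0 r ρ else p1 ρ : I) : ℝ)) := by
    simp only [winProb, pA]; ring
  have hw' : winProb r ρ γ y = (γ : ℝ) * (pA : ℝ)
      + (1 - (γ : ℝ)) * ((if (r : ℤ) ∣ y then p0 r ρ else p1 ρ : I) : ℝ) := by
    simp only [winProb, pA]
  rw [hw, hw']
  generalize (if (r : ℤ) ∣ y then p0 r ρ else p1 ρ : I) = b
  have h0 := γ.2.1
  have h1 : (0 : ℝ) ≤ 1 - γ := sub_nonneg.2 γ.2.2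
  have h2 : (0 : ℝ) ≤ 1 - b := sub_nonneg.2 b.2.2
  have h3 : (0 : ℝ) ≤ 1 - (pA : ℝ) := sub_nonneg.2 pA.2.2
  have h4 := b.2.1
  have h5 := pA.2.1
  rw [ENNReal.ofReal_add (by positivity) (by positivity),
    ENNReal.ofReal_add (by positivity) (by positivity),
    ENNReal.ofReal_mul h0, ENNReal.ofReal_mul h0, ENNReal.ofReal_mul h1, ENNReal.ofReal_mul h1]
  simp only [smul_eq_mul]
  ring

/-! ### Markov property and unit steps -/

/-- The Markov property of the capital, for functionals of two successive capitals. -/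
theorem lintegral_capitalLaw_succ (r : ℕ) (ρ : ℝ≥0) (γ : I) (x : ℤ) (n : ℕ)
    (g : ℤ → ℤ → ℝ≥0∞) :
    ∫⁻ c, g (c n) (c (n + 1)) ∂capitalLaw r ρ γ x
      = ∫⁻ c, ∫⁻ z, g (c n) z ∂mixture r ρ γ (c n) ∂capitalLaw r ρ γ x := by
  have hg : Measurable (Function.uncurry g) := measurable_of_countable _
  have hG : Measurable (fun w : ((_ : Finset.Iic n) → ℤ) × ℤ =>
      g (w.1 ⟨n, Finset.mem_Iic.2 le_rfl⟩) w.2) :=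
    have h : Measurable (fun w : ((_ : Finset.Iic n) → ℤ) × ℤ =>
        (w.1 ⟨n, Finset.mem_Iic.2 le_rfl⟩, w.2)) := by fun_prop
    hg.comp h
  have key := Kernel.partialTraj_compProd_eq_map_traj (X := fun _ => ℤ)
    (κ := transition r ρ γ) (Nat.zero_le n) (x₀ := fun _ => x)
  have hm : Measurable (fun c : ℕ → ℤ => (Preorder.frestrictLe (π := fun _ => ℤ) n c, c (n + 1))) := by
    fun_prop
  calc ∫⁻ c, g (c n) (c (n + 1)) ∂capitalLaw r ρ γ x
      = ∫⁻ w, g (w.1 ⟨n, Finset.mem_Iic.2 le_rfl⟩) w.2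
          ∂((capitalLaw r ρ γ x).map
            (fun c : ℕ → ℤ => (Preorder.frestrictLe (π := fun _ => ℤ) n c, c (n + 1)))) := by
        rw [lintegral_map hG hm]; rfl
    _ = ∫⁻ h, ∫⁻ z, g (h ⟨n, Finset.mem_Iic.2 le_rfl⟩) z ∂transition r ρ γ n h
          ∂(Kernel.partialTraj (X := fun _ => ℤ) (transition r ρ γ) 0 n (fun _ => x)) := by
        rw [capitalLaw, ← key, Measure.lintegral_compProd hG]
    _ = _ := by
        rw [← Kernel.traj_map_frestrictLe_apply, lintegral_map]
        · rfl
        · exact hG.lintegral_kernel_prod_right'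
        · fun_prop

theorem capitalLaw_zero_ae (r : ℕ) (ρ : ℝ≥0) (γ : I) (x : ℤ) :
    ∀ᵐ c ∂capitalLaw r ρ γ x, c 0 = x := by
  have h := Kernel.traj_map_frestrictLe_apply (X := fun _ => ℤ) (κ := transition r ρ γ) 0 0
    (fun _ => x)
  rw [Kernel.partialTraj_self, Kernel.id_apply] at h
  have h2 : ∀ᵐ w ∂((capitalLaw r ρ γ x).map (Preorder.frestrictLe (π := fun _ => ℤ) 0)),
      w ⟨0, Finset.mem_Iic.2 le_rfl⟩ = x := by
    rw [capitalLaw, h, ae_dirac_iff]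
    exact (measurable_pi_apply (X := fun _ : Finset.Iic 0 => ℤ) _) (measurableSet_singleton x)
  exact ae_of_ae_map (by fun_prop) h2

theorem capitalLaw_step_ae (r : ℕ) (ρ : ℝ≥0) (γ : I) (x : ℤ) :
    ∀ᵐ c ∂capitalLaw r ρ γ x, ∀ n, |c (n + 1) - c n| ≤ 1 := by
  rw [ae_all_iff]
  intro n
  -- The indicator of a jump larger than 1 has mean zero.
  have h := lintegral_capitalLaw_succ r ρ γ x n
    (fun y z => if |z - y| ≤ 1 then 0 else 1)
  simp only [lintegral_mixture] at h
  simp only [add_sub_cancel_left, abs_one, le_refl, if_true, sub_sub_cancel_left, abs_neg,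
    mul_zero, add_zero, lintegral_zero] at h
  rw [lintegral_eq_zero_iff] at h
  · filter_upwards [h] with c hc
    by_contra hne
    simp [hne] at hc
  · have hpair : Measurable (fun c : ℕ → ℤ => (c n, c (n + 1))) := by fun_prop
    exact (measurable_of_countable
      (fun w : ℤ × ℤ => if |w.2 - w.1| ≤ 1 then (0 : ℝ≥0∞) else 1)).comp hpair

/-! ### From the Poisson equation to the almost sure limit -/

/-- If `f` solves the Poisson equation with constant `m` and has bounded increments, the second
moment of the martingale `f (c n) - f x - n m` grows at most linearly. -/
theorem lintegral_sq_le {r : ℕ} {ρ : ℝ≥0} {γ : I} {m B : ℝ} (f : ℤ → ℝ) (x : ℤ)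
    (hup : ∀ y, |f (y + 1) - f y - m| ≤ B) (hdown : ∀ y, |f (y - 1) - f y - m| ≤ B)
    (hf : ∀ y, winProb r ρ γ y * f (y + 1) + (1 - winProb r ρ γ y) * f (y - 1) = f y + m)
    (n : ℕ) :
    ∫⁻ c, ENNReal.ofReal ((f (c n) - f x - n * m) ^ 2) ∂capitalLaw r ρ γ x
      ≤ ENNReal.ofReal (n * B ^ 2) := by
  induction n with
  | zero =>
    refine le_of_eq_of_le (lintegral_eq_zero_of_ae_eq_zero ?_) zero_le
    filter_upwards [capitalLaw_zero_ae r ρ γ x] with c hc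
    simp [hc]
  | succ n ih =>
    rw [lintegral_capitalLaw_succ r ρ γ x n
      (fun _ z => ENNReal.ofReal ((f z - f x - ((n + 1 : ℕ) : ℝ) * m) ^ 2))]
    have hstep : ∀ y, ∫⁻ z, ENNReal.ofReal ((f z - f x - ((n + 1 : ℕ) : ℝ) * m) ^ 2)
        ∂mixture r ρ γ y ≤ ENNReal.ofReal ((f y - f x - n * m) ^ 2) + ENNReal.ofReal (B ^ 2) := by
      intro y
      have hw := winProb_nonneg r ρ γ y
      have hw' : 0 ≤ 1 - winProb r ρ γ y := sub_nonneg.2 (winProb_le_one r ρ γ y)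
      rw [lintegral_mixture, ← ENNReal.ofReal_mul hw, ← ENNReal.ofReal_mul hw',
        ← ENNReal.ofReal_add (by positivity) (by positivity),
        ← ENNReal.ofReal_add (by positivity) (by positivity)]
      apply ENNReal.ofReal_le_ofReal
      have hu := sq_le_sq' (abs_le.1 (hup y)).1 (abs_le.1 (hup y)).2
      have hd := sq_le_sq' (abs_le.1 (hdown y)).1 (abs_le.1 (hdown y)).2
      have h := hf y
      push_cast
      generalize winProb r ρ γ y = w at *
      -- Martingale increments have conditional mean zero, so the cross term of the square vanishes.
      have hcross : w * (f (y + 1) - f y - m) + (1 - w) * (f (y - 1) - f y - m) = 0 := by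
        linarith
      calc w * (f (y + 1) - f x - (n + 1) * m) ^ 2 + (1 - w) * (f (y - 1) - f x - (n + 1) * m) ^ 2
          = (f y - f x - n * m) ^ 2
            + 2 * (f y - f x - n * m)
              * (w * (f (y + 1) - f y - m) + (1 - w) * (f (y - 1) - f y - m))
            + (w * (f (y + 1) - f y - m) ^ 2 + (1 - w) * (f (y - 1) - f y - m) ^ 2) := by ring
        _ ≤ (f y - f x - n * m) ^ 2 + 2 * (f y - f x - n * m) * 0
            + (w * B ^ 2 + (1 - w) * B ^ 2) := by rw [hcross]; gcongr
        _ = _ := by ring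
    calc _ ≤ ∫⁻ c, (ENNReal.ofReal ((f (c n) - f x - n * m) ^ 2) + ENNReal.ofReal (B ^ 2))
          ∂capitalLaw r ρ γ x := lintegral_mono fun c => hstep (c n)
      _ = ∫⁻ c, ENNReal.ofReal ((f (c n) - f x - n * m) ^ 2) ∂capitalLaw r ρ γ x
          + ENNReal.ofReal (B ^ 2) := by
        rw [lintegral_add_right _ measurable_const]; simp
      _ ≤ ENNReal.ofReal (n * B ^ 2) + ENNReal.ofReal (B ^ 2) := by gcongr
      _ = _ := by
        rw [← ENNReal.ofReal_add (by positivity) (by positivity)]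
        congr 1; push_cast; ring

/-- A real sequence with bounded increments that is `o(n)` along the squares is `o(n)`. -/
theorem tendsto_div_of_tendsto_sq {u : ℕ → ℝ} {D : ℝ} (hD : ∀ n, |u (n + 1) - u n| ≤ D)
    (h : Tendsto (fun k : ℕ => u (k ^ 2) / (k : ℝ) ^ 2) atTop (𝓝 0)) :
    Tendsto (fun n : ℕ => u n / n) atTop (𝓝 0) := by
  have hD0 : 0 ≤ D := (abs_nonneg _).trans (hD 0)
  have hinc : ∀ n j, |u (n + j) - u n| ≤ j * D := by
    intro n j
    induction j with
    | zero => simp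
    | succ j ih =>
      calc |u (n + (j + 1)) - u n| = |(u (n + j + 1) - u (n + j)) + (u (n + j) - u n)| := by
            rw [← add_assoc]; congr 1; ring
        _ ≤ D + j * D := (abs_add_le _ _).trans (add_le_add (hD _) ih)
        _ = _ := by push_cast; ring
  have hsqrt : Tendsto Nat.sqrt atTop atTop :=
    tendsto_atTop.2 fun b => (eventually_ge_atTop (b * b)).mono fun n hn => Nat.le_sqrt.2 hn
  have hlim : Tendsto (fun k : ℕ => |u (k ^ 2) / (k : ℝ) ^ 2| + 2 * D / (k : ℝ)) atTop (𝓝 0) := by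
    simpa using h.abs.add (tendsto_const_div_atTop_nhds_zero_nat (2 * D))
  refine squeeze_zero_norm' ?_ (hlim.comp hsqrt)
  filter_upwards [eventually_ge_atTop 1] with n hn
  -- Every n is within 2k of k², so the gap contributes at most 2kD/k² = 2D/k.
  obtain ⟨k, hk⟩ : ∃ k, k = Nat.sqrt n := ⟨_, rfl⟩
  have hk1 : 1 ≤ k := hk ▸ Nat.le_sqrt.2 (by simpa using hn)
  have hle : k ^ 2 ≤ n := hk ▸ Nat.sqrt_le' n
  have hlt : n ≤ k ^ 2 + 2 * k := by
    have := Nat.sqrt_le_add n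
    rw [← hk] at this; nlinarith
  obtain ⟨j, rfl⟩ := Nat.exists_eq_add_of_le hle
  have hj : (j : ℝ) ≤ 2 * k := by
    have : j ≤ 2 * k := by omega
    exact_mod_cast this
  have hk0 : (0 : ℝ) < k := by exact_mod_cast hk1
  have hb : |u (k ^ 2 + j)| ≤ |u (k ^ 2)| + 2 * k * D := by
    calc |u (k ^ 2 + j)| = |u (k ^ 2) + (u (k ^ 2 + j) - u (k ^ 2))| := by congr 1; ring
      _ ≤ |u (k ^ 2)| + j * D := (abs_add_le _ _).trans (by gcongr; exact hinc _ _)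
      _ ≤ _ := by gcongr
  simp only [Function.comp_apply, ← hk]
  rw [Real.norm_eq_abs, abs_div, Nat.abs_cast, abs_div, abs_of_pos (pow_pos hk0 2)]
  calc |u (k ^ 2 + j)| / ((k ^ 2 + j : ℕ) : ℝ) ≤ (|u (k ^ 2)| + 2 * k * D) / (k : ℝ) ^ 2 := by
        gcongr
        exact_mod_cast hle
    _ = _ := by field_simp

/-- If the Poisson equation with constant `m` has a solution at bounded distance from the identity,
then `m` is the rate of profit. -/
theorem isRateOfProfit_of_poisson {r : ℕ} {ρ : ℝ≥0} {γ : I} {m C : ℝ} (f : ℤ → ℝ)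
    (hC : ∀ y : ℤ, |f y - y| ≤ C)
    (hf : ∀ y, winProb r ρ γ y * f (y + 1) + (1 - winProb r ρ γ y) * f (y - 1) = f y + m)
    (x : ℤ) : IsRateOfProfit r ρ γ x m := by
  set B : ℝ := 1 + 2 * C + |m| with hB
  have hup : ∀ y, |f (y + 1) - f y - m| ≤ B := by
    intro y
    have h1 := abs_le.1 (hC (y + 1))
    have h2 := abs_le.1 (hC y)
    push_cast at h1
    rw [abs_le]
    constructor <;> linarith [h1.1, h1.2, h2.1, h2.2, neg_abs_le m, le_abs_self m]
  have hdown : ∀ y, |f (y - 1) - f y - m| ≤ B := by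
    intro y
    have h1 := abs_le.1 (hC (y - 1))
    have h2 := abs_le.1 (hC y)
    push_cast at h1
    rw [abs_le]
    constructor <;> linarith [h1.1, h1.2, h2.1, h2.2, neg_abs_le m, le_abs_self m]
  have hmeas : ∀ n : ℕ, Measurable (fun c : ℕ → ℤ => f (c n) - f x - n * m) := fun n =>
    (((measurable_of_countable f).comp (measurable_pi_apply n)).sub_const _).sub_const _
  -- The k-th term has mean at most k²B²/k⁴ = B²/k², and finite total mean gives almost sure
  -- summability. At k = 0 division by zero makes the term 0.
  have hsum : ∀ᵐ c ∂capitalLaw r ρ γ x, Summable fun k : ℕ =>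
      ((f (c (k ^ 2)) - f x - ((k ^ 2 : ℕ) : ℝ) * m) / (k : ℝ) ^ 2) ^ 2 := by
    have hfin : ∫⁻ c, ∑' k : ℕ, ENNReal.ofReal
        (((f (c (k ^ 2)) - f x - ((k ^ 2 : ℕ) : ℝ) * m) / (k : ℝ) ^ 2) ^ 2)
        ∂capitalLaw r ρ γ x ≠ ∞ := by
      rw [lintegral_tsum fun k =>
        (((hmeas (k ^ 2)).div_const _).pow_const 2).ennreal_ofReal.aemeasurable]
      have hs : Summable fun k : ℕ => B ^ 2 * (1 / (k : ℝ) ^ 2) :=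
        (Real.summable_one_div_nat_pow.2 one_lt_two).mul_left _
      refine ne_top_of_le_ne_top hs.tsum_ofReal_ne_top (ENNReal.tsum_le_tsum fun k => ?_)
      calc _ = ∫⁻ c, ENNReal.ofReal (1 / ((k : ℝ) ^ 2) ^ 2)
            * ENNReal.ofReal ((f (c (k ^ 2)) - f x - ((k ^ 2 : ℕ) : ℝ) * m) ^ 2)
            ∂capitalLaw r ρ γ x := by
              congr 1; ext c
              rw [← ENNReal.ofReal_mul (by positivity)]
              congr 1; rw [div_pow]; ring
        _ = ENNReal.ofReal (1 / ((k : ℝ) ^ 2) ^ 2)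
            * ∫⁻ c, ENNReal.ofReal ((f (c (k ^ 2)) - f x - ((k ^ 2 : ℕ) : ℝ) * m) ^ 2)
            ∂capitalLaw r ρ γ x :=
              lintegral_const_mul _ ((hmeas (k ^ 2)).pow_const 2).ennreal_ofReal
        _ ≤ ENNReal.ofReal (1 / ((k : ℝ) ^ 2) ^ 2)
            * ENNReal.ofReal (((k ^ 2 : ℕ) : ℝ) * B ^ 2) := by
              gcongr; exact lintegral_sq_le f x hup hdown hf _
        _ = _ := by
              rw [← ENNReal.ofReal_mul (by positivity)]
              congr 1
              push_cast
              rcases eq_or_ne (k : ℝ) 0 with h | h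
              · simp [h]
              · field_simp
    filter_upwards [ae_lt_top' (AEMeasurable.tsum fun k =>
      (((hmeas (k ^ 2)).div_const _).pow_const 2).ennreal_ofReal.aemeasurable) hfin] with c hc
    exact (ENNReal.summable_toReal hc.ne).congr fun k => ENNReal.toReal_ofReal (sq_nonneg _)
  filter_upwards [hsum, capitalLaw_step_ae r ρ γ x] with c hc hstep
  have hsq : Tendsto (fun k : ℕ =>
      (f (c (k ^ 2)) - f x - ((k ^ 2 : ℕ) : ℝ) * m) / (k : ℝ) ^ 2) atTop (𝓝 0) := by
    have h := (Real.continuous_sqrt.tendsto 0).comp hc.tendsto_atTop_zero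
    rw [Real.sqrt_zero] at h
    refine (tendsto_zero_iff_abs_tendsto_zero _).2 (h.congr fun k => ?_)
    simp [Real.sqrt_sq_eq_abs]
  have hlin : Tendsto (fun k : ℕ =>
      ((c (k ^ 2) : ℝ) - c 0 - ((k ^ 2 : ℕ) : ℝ) * m) / (k : ℝ) ^ 2) atTop (𝓝 0) := by
    have herr : Tendsto (fun k : ℕ =>
        ((c (k ^ 2) : ℝ) - f (c (k ^ 2)) + (f x - c 0)) / (k : ℝ) ^ 2) atTop (𝓝 0) := by
      have hz : Tendsto (fun k : ℕ => (C + |f x - c 0|) / (k : ℝ) ^ 2) atTop (𝓝 0) :=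
        tendsto_const_nhds.div_atTop
          ((tendsto_pow_atTop two_ne_zero).comp tendsto_natCast_atTop_atTop)
      refine squeeze_zero_norm (fun k => ?_) hz
      rw [Real.norm_eq_abs, abs_div, abs_of_nonneg (by positivity : (0 : ℝ) ≤ (k : ℝ) ^ 2)]
      gcongr
      refine (abs_add_le _ _).trans ?_
      gcongr
      rw [abs_sub_comm]; exact hC _
    refine (add_zero (0 : ℝ) ▸ hsq.add herr).congr fun k => ?_
    ring
  have hmain := tendsto_div_of_tendsto_sq (u := fun n => (c n : ℝ) - c 0 - (n : ℝ) * m)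
    (D := 1 + |m|) (fun n => by
      have h : |(c (n + 1) : ℝ) - c n| ≤ 1 := by exact_mod_cast hstep n
      calc _ = |((c (n + 1) : ℝ) - c n) - m| := by push_cast; congr 1; ring
        _ ≤ _ := (abs_sub _ _).trans (by gcongr)) hlin
  have h2 := hmain.add_const m
  rw [zero_add] at h2
  refine h2.congr' ?_
  filter_upwards [eventually_ge_atTop 1] with n hn
  have : (n : ℝ) ≠ 0 := by positivity
  push_cast
  field_simp
  ring

/-! ### Explicit solution for ρ = 0 -/

theorem winProb_zero {r : ℕ} (hr : 2 ≤ r) (γ : I) (y : ℤ) :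
    winProb r 0 γ y = if (r : ℤ) ∣ y then (γ : ℝ) / 2 else 1 - (γ : ℝ) / 2 := by
  -- Needed so that 0 ^ (r - 1) is 0 and not 1.
  have h : r - 1 ≠ 0 := by omega
  unfold winProb
  split_ifs <;> simp [p0, p1, h] <;> ring

/-- A potential on `{0, …, r}` that solves the Poisson equation inside a period and at its end
extends to a solution on `ℤ`. -/
theorem isRateOfProfit_of_potential {r : ℕ} (hr : 2 ≤ r) {γ : I} {q m : ℝ} (hq : (γ : ℝ) = 2 * q)
    (F : ℕ → ℝ) (hF0 : F 0 = 0) (hFr : F r = r)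
    (hF : ∀ k, (1 - q) * F (k + 2) + q * F k = F (k + 1) + m)
    (hend : q * F 1 + (1 - q) * (F (r - 1) - r) = m) (x : ℤ) :
    IsRateOfProfit r 0 γ x m := by
  have hr0 : (r : ℤ) ≠ 0 := by omega
  set f : ℤ → ℝ := fun y => r * ((y / r : ℤ) : ℝ) + F (y % r).toNat with hfdef
  -- Allowing k = r, where `hF0` and `hFr` glue adjacent periods, lets y + 1 be treated without a
  -- case split.
  have hval : ∀ (t : ℤ) (k : ℕ), k ≤ r → f (r * t + k) = r * t + F k := by
    intro t k hk
    rcases hk.lt_or_eq with hlt | rfl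
    · have h1 : ((r : ℤ) * t + k) / r = t := by
        rw [Int.mul_add_ediv_left _ _ hr0, Int.ediv_eq_zero_of_lt (by omega) (by omega), add_zero]
      have h2 : ((r : ℤ) * t + k) % r = k := by
        rw [Int.mul_add_emod_self_left, Int.emod_eq_of_lt (by omega) (by omega)]
      simp only [hfdef, h1, h2, Int.toNat_natCast]
    · have h1 : ((k : ℤ) * t + k) / k = t + 1 := by
        rw [Int.mul_add_ediv_left _ _ hr0, Int.ediv_self hr0]
      have h2 : ((k : ℤ) * t + k) % k = 0 := by simp
      simp only [hfdef, h1, h2, Int.toNat_zero, hF0, hFr]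
      push_cast; ring
  have hdecomp : ∀ y : ℤ, ∃ (t : ℤ) (k : ℕ), k < r ∧ y = r * t + k := fun y =>
    ⟨y / r, (y % r).toNat, by
      have := Int.emod_lt_of_pos y (by omega : (0 : ℤ) < r)
      have := Int.emod_nonneg y hr0
      omega, by
      rw [Int.toNat_of_nonneg (Int.emod_nonneg y hr0), Int.mul_ediv_add_emod]⟩
  refine isRateOfProfit_of_poisson (C := ∑ k ∈ Finset.range r, |F k - k|) f (fun y => ?_)
    (fun y => ?_) x
  · obtain ⟨t, k, hk, rfl⟩ := hdecomp y
    rw [hval t k hk.le]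
    push_cast
    rw [add_sub_add_left_eq_sub]
    exact Finset.single_le_sum (f := fun k : ℕ => |F k - k|) (fun i _ => abs_nonneg _)
      (Finset.mem_range.2 hk)
  · obtain ⟨t, k, hk, rfl⟩ := hdecomp y
    have hu : f (r * t + k + 1) = r * t + F (k + 1) := by
      rw [← hval t (k + 1) hk]; push_cast; rw [add_assoc]
    rw [hu, hval t k hk.le, winProb_zero hr, hq]
    rcases k with _ | k
    · have hd : f (r * t + (0 : ℕ) - 1) = r * (t - 1) + F (r - 1) := by
        have h := hval (t - 1) (r - 1) (by omega)
        push_cast [Nat.cast_sub (by omega : 1 ≤ r)] at h ⊢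
        rw [← h]; congr 1; ring
      rw [hd, if_pos (by simp), hF0, ← hend]
      ring
    · have hd : f (r * t + (k + 1 : ℕ) - 1) = r * t + F k := by
        rw [← hval t k (by omega)]; congr 1; push_cast; ring
      have hnd : ¬ (r : ℤ) ∣ r * t + (k + 1 : ℕ) := by
        rw [Int.dvd_add_right (Dvd.intro _ rfl), Int.natCast_dvd_natCast]
        exact Nat.not_dvd_of_pos_of_lt (Nat.succ_pos k) hk
      rw [hd, if_neg hnd]
      have := hF k
      linarith

/-- The ratio `(1 - s ^ r) / (1 - s ^ (r - 2))` with `s = q / (1 - q)`. -/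
def cycleRatio (r : ℕ) (q : ℝ) : ℝ :=
  (1 - (q / (1 - q)) ^ r) / (1 - (q / (1 - q)) ^ (r - 2))

/-- The rate of profit for `ρ = 0` and `γ = 2 q`. -/
def profitRate (r : ℕ) (q : ℝ) : ℝ :=
  (1 - 2 * q) / (1 + 2 * (1 - q) * cycleRatio r q / (q * r))

theorem cycleRatio_pos {r : ℕ} (hr : 3 ≤ r) {q : ℝ} (hq0 : 0 < q) (hq : q < 1 / 2) :
    0 < cycleRatio r q := by
  have hs0 : 0 ≤ q / (1 - q) := div_nonneg hq0.le (by linarith)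
  have hs1 : q / (1 - q) < 1 := (div_lt_one (by linarith)).2 (by linarith)
  exact div_pos (sub_pos.2 (pow_lt_one₀ hs0 hs1 (by omega)))
    (sub_pos.2 (pow_lt_one₀ hs0 hs1 (by omega)))

theorem isRateOfProfit_profitRate {r : ℕ} (hr : 3 ≤ r) {γ : I} {q : ℝ} (hγ : (γ : ℝ) = 2 * q)
    (hq0 : 0 < q) (hq : q < 1 / 2) (x : ℤ) : IsRateOfProfit r 0 γ x (profitRate r q) := by
  obtain ⟨j, rfl⟩ := Nat.exists_eq_add_of_le' (show 2 ≤ r by omega)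
  have hj : j ≠ 0 := by omega
  have hκ := cycleRatio_pos hr hq0 hq
  set κ := cycleRatio (j + 2) q with hκdef
  set m := profitRate (j + 2) q with hm
  have hp : 0 < 1 - q := by linarith
  have hpq : 0 < 1 - 2 * q := by linarith
  obtain ⟨s, hs⟩ : ∃ s, s = q / (1 - q) := ⟨_, rfl⟩
  have hs0 : 0 ≤ s := hs ▸ div_nonneg hq0.le hp.le
  have hs1 : s < 1 := hs ▸ (div_lt_one hp).2 (by linarith)
  have hps : (1 - q) * s = q := by rw [hs]; field_simp
  have hsj : 0 < 1 - s ^ j := sub_pos.2 (pow_lt_one₀ hs0 hs1 hj)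
  have hκs : κ * (1 - s ^ j) = 1 - s ^ (j + 2) := by
    rw [hκdef, cycleRatio, ← hs, Nat.add_sub_cancel, div_mul_cancel₀ _ hsj.ne']
  have h1s : (1 - q) * (1 - s) = 1 - 2 * q := by linarith
  have h1s0 : 0 < 1 - s := by linarith
  have hr0 : (0 : ℝ) < ((j + 2 : ℕ) : ℝ) := by positivity
  have hmr : m * (((j + 2 : ℕ) : ℝ) + 2 * (1 - q) * κ / q) = (1 - 2 * q) * ((j + 2 : ℕ) : ℝ) := by
    have hden : 1 + 2 * (1 - q) * κ / (q * ((j + 2 : ℕ) : ℝ)) ≠ 0 := by positivity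
    have hm' : m * (1 + 2 * (1 - q) * κ / (q * ((j + 2 : ℕ) : ℝ))) = 1 - 2 * q := by
      rw [hm, profitRate, ← hκdef, div_mul_cancel₀ _ hden]
    rw [← hm']
    field_simp
  obtain ⟨a, ha⟩ : ∃ a, a * (1 - 2 * q) = m := ⟨m / (1 - 2 * q), div_mul_cancel₀ _ hpq.ne'⟩
  -- `a` is the slope of the linear solution. Given F r = r, the equation at multiples of r reduces
  -- to this condition on `b`; F r = r itself then determines `m`.
  obtain ⟨b, hb⟩ : ∃ b, b * ((1 - s) * q * (1 - s ^ j)) = 2 * m :=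
    ⟨_, div_mul_cancel₀ _ (by positivity)⟩
  have hbr : b * (1 - s ^ (j + 2)) * (1 - 2 * q) = m * (2 * (1 - q) * κ / q) := by
    rw [← hκs, ← h1s]
    have : m * (2 * (1 - q) * κ / q) = (2 * m) * (1 - q) * κ / q := by ring
    rw [this, ← hb]
    field_simp
  have hFr : a * ((j + 2 : ℕ) : ℝ) + b * (1 - s ^ (j + 2)) = ((j + 2 : ℕ) : ℝ) := by
    apply mul_right_cancel₀ hpq.ne'
    linear_combination hbr + hmr + ((j + 2 : ℕ) : ℝ) * ha
  refine isRateOfProfit_of_potential (by omega) hγ (fun k => a * k + b * (1 - s ^ k)) (by simp)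
    hFr (fun k => ?_) ?_ x
  · push_cast
    -- 1 and s are the characteristic roots of the recurrence.
    linear_combination ha - b * s ^ k * (s - 1) * hps
  · simp only [show j + 2 - 1 = j + 1 by omega]
    push_cast at hFr ⊢
    linear_combination (1 - q) * hFr - ha + hb - b * s ^ j * (1 - s) * hps

/-! ### Asymptotics -/

theorem tendsto_cycleRatio {q : ℕ → ℝ} (hq0 : ∀ᶠ r in atTop, 0 ≤ q r)
    (hq : Tendsto q atTop (𝓝 0)) : Tendsto (fun r => cycleRatio r (q r)) atTop (𝓝 1) := by
  have hs : Tendsto (fun r => q r / (1 - q r)) atTop (𝓝 0) := by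
    have h := hq.div (hq.const_sub 1) (by norm_num)
    rw [zero_div] at h
    exact h
  -- For 0 ≤ s ≤ 1 and a nonzero exponent, s ^ e ≤ s.
  have hpow : ∀ e : ℕ → ℕ, (∀ᶠ r in atTop, e r ≠ 0) →
      Tendsto (fun r => (q r / (1 - q r)) ^ e r) atTop (𝓝 0) := by
    intro e he
    refine squeeze_zero' ?_ ?_ hs
    · filter_upwards [hq0, hq.eventually_lt_const one_pos] with r h0 h1
      exact pow_nonneg (div_nonneg h0 (by linarith)) _
    · filter_upwards [he, hq0, hq.eventually_lt_const one_pos,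
        hs.eventually_lt_const one_pos] with r her h0 h1 h2
      exact pow_le_of_le_one (div_nonneg h0 (by linarith)) h2.le her
  have h1 := hpow (fun r => r) (eventually_ne_atTop 0)
  have h2 := hpow (fun r => r - 2) ((eventually_ge_atTop 3).mono fun r hr => by omega)
  have h := (h1.const_sub 1).div (h2.const_sub 1) (by norm_num)
  rw [sub_zero, div_one] at h
  exact h

theorem isEquivalent_one_sub_profitRate :
    (fun r : ℕ => 1 - profitRate r (1 / √(r : ℝ))) ~[atTop] fun r : ℕ => 2 * (2 / √(r : ℝ)) := by
  have hq : Tendsto (fun r : ℕ => 1 / √(r : ℝ)) atTop (𝓝 0) :=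
    tendsto_const_nhds.div_atTop (Real.tendsto_sqrt_atTop.comp tendsto_natCast_atTop_atTop)
  have hκ := tendsto_cycleRatio (Eventually.of_forall fun r => by positivity) hq
  have hpκ : Tendsto (fun r : ℕ => (1 - 1 / √(r : ℝ)) * cycleRatio r (1 / √(r : ℝ))) atTop
      (𝓝 1) := by
    simpa using (hq.const_sub 1).mul hκ
  -- This is (1 - m)/(4q) after cancelling 2q.
  have hlim : Tendsto (fun r : ℕ =>
      ((1 - 1 / √(r : ℝ)) * cycleRatio r (1 / √(r : ℝ)) + 1)
        / (2 * (1 + 2 * (1 / √(r : ℝ)) * ((1 - 1 / √(r : ℝ)) * cycleRatio r (1 / √(r : ℝ))))))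
      atTop (𝓝 1) := by
    have := (hpκ.add_const 1).div ((((hq.const_mul 2).mul hpκ).const_add 1).const_mul 2)
      (by norm_num)
    norm_num at this ⊢
    exact this
  refine isEquivalent_of_tendsto_one (hlim.congr' ?_)
  filter_upwards [eventually_ge_atTop 5] with r hr
  have hr5 : (5 : ℝ) ≤ r := by exact_mod_cast hr
  have hsq : √(r : ℝ) ^ 2 = r := Real.sq_sqrt (by positivity)
  have h2 : (2 : ℝ) < √(r : ℝ) := Real.lt_sqrt_of_sq_lt (by linarith)
  have hq0 : 0 < 1 / √(r : ℝ) := by positivity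
  have hq1 : 1 / √(r : ℝ) < 1 / 2 := one_div_lt_one_div_of_lt two_pos h2
  have hκ0 := cycleRatio_pos (by omega : 3 ≤ r) hq0 hq1
  simp only [Pi.div_apply, profitRate]
  have hqr : 1 / √(r : ℝ) * r = (1 / √(r : ℝ))⁻¹ := by
    rw [one_div, inv_inv]; nth_rw 2 [← hsq]; field_simp
  have h4 : 2 * (2 / √(r : ℝ)) = 4 * (1 / √(r : ℝ)) := by ring
  rw [hqr, h4]
  generalize cycleRatio r (1 / √(r : ℝ)) = κ at *
  generalize 1 / √(r : ℝ) = q at *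
  have hp : 0 < 1 - q := by linarith
  have hd : 0 < 1 + 2 * q * ((1 - q) * κ) := by positivity
  have hd' : 1 + 2 * (1 - q) * κ / q⁻¹ = 1 + 2 * q * ((1 - q) * κ) := by
    rw [div_inv_eq_mul]; ring
  rw [hd']
  field_simp
  ring

end

end Parrondo

theorem corollary5 :
    ∃ μ : ℕ → ℝ,
      (∀ (r : ℕ) (hr : 5 ≤ r) (x : ℤ),
        Parrondo.IsRateOfProfit r 0 (Parrondo.gammaSeq r hr) x (μ r)) ∧
      (fun r : ℕ => 1 - μ r) ~[atTop] (fun r : ℕ => 2 * (2 / √(r : ℝ))) := by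
  refine ⟨fun r => Parrondo.profitRate r (1 / √(r : ℝ)), fun r hr x => ?_,
    Parrondo.isEquivalent_one_sub_profitRate⟩
  have hr5 : (5 : ℝ) ≤ r := by exact_mod_cast hr
  have h2 : (2 : ℝ) < √(r : ℝ) := Real.lt_sqrt_of_sq_lt (by linarith)
  refine Parrondo.isRateOfProfit_profitRate (by omega) ?_ (by positivity)
    (one_div_lt_one_div_of_lt two_pos h2) x
  change 2 / √(r : ℝ) = 2 * (1 / √(r : ℝ))
  ring
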